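/- Let $\mathcal H$ be a separable complex Hilbert space and let $\rho$ be a density operator (a positive trace class operator of trace one) on the Hilbert space tensor product $\mathcal H\otimes\mathcal H$. For $k=1,2,3$ let $\mathrm{tr}^{(k)}$ denote the partial trace over the $k$-th factor of $\mathcal H\otimes\mathcal H\otimes\mathcal H$. A source-operator for $\rho$ is a self-adjoint trace class operator $T$ on $\mathcal H\otimes\mathcal H\otimes\mathcal H$ such that either $\mathrm{tr}^{(1)}[T]=\mathrm{tr}^{(2)}[T]=\rho$ or $\mathrm{tr}^{(2)}[T]=\mathrm{tr}^{(3)}[T]=\rho$. The state $\rho$ is a density source-operator (DSO) state if it has a positive source-operator, and it is symmetric if $V\rho V=\rho$, where $V$ is the permutation operator $V(\psi_1\otimes\psi_2)=\psi_2\otimes\psi_1$. Let $\gamma_{nm}$, $n,m=1,2$, be real coefficients with $|\gamma_{nm}|\le 1$ such that $$\gamma_{11}\gamma_{12}=-\gamma_{21}\gamma_{22}\quad\text{or}\quad \gamma_{11}\gamma_{21}=-\gamma_{12}\gamma_{22}.$$ If $\rho$ is a symmetric DSO state on $\mathcal H\otimes\mathcal H$, then for all bounded self-adjoint operators $A_1,A_2,B_1,B_2$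 on $\mathcal H$ with operator norms at most $1$, the operators $\rho(A_n\otimes B_m)$ are trace class and $$\Bigl|\sum_{n,m=1,2}\gamma_{nm}\,\mathrm{tr}\bigl[\rho\,(A_n\otimes B_m)\bigr]\Bigr|\le 2 .$$ -/

import Mathlib

open scoped TensorProduct InnerProductSpace

universe u v w

noncomputable section

namespace QuantumDSO

section Trace

variable {E : Type u} [NormedAddCommGroup E] [InnerProductSpace ℂ E]

/-- Hilbert–Schmidt operators: `∑ ‖T eᵢ‖² < ∞` for every orthonormal (Hilbert) basis `(eᵢ)`. -/
def IsHilbertSchmidt (T : E →L[ℂ] E) : Prop :=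
  ∀ (ι : Type u) (e : HilbertBasis ι ℂ E), Summable fun i => ‖T (e i)‖ ^ 2

/-- Trace class operators: products of two Hilbert–Schmidt operators. -/
def IsTraceClass (T : E →L[ℂ] E) : Prop :=
  ∃ A B : E →L[ℂ] E, IsHilbertSchmidt A ∧ IsHilbertSchmidt B ∧ T = A ∘L B

/-- The trace `∑ ⟨eᵢ, T eᵢ⟩` over a Hilbert basis `(eᵢ)`; for a trace class operator the series
converges absolutely and its sum does not depend on the basis. -/
def trace [CompleteSpace E] (T : E →L[ℂ] E) : ℂ :=
  ∑' i, ⟪(exists_hilbertBasis ℂ E).choose_spec.choose i,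
    T ((exists_hilbertBasis ℂ E).choose_spec.choose i)⟫_ℂ

/-- Density operators (normal quantum states). -/
structure IsDensityOperator [CompleteSpace E] (ρ : E →L[ℂ] E) : Prop where
  isPositive : ρ.IsPositive
  isTraceClass : IsTraceClass ρ
  trace_eq_one : trace ρ = 1

end Trace

section Tensor

/-- The Hilbert space tensor product: the completion of the algebraic tensor product with respect
to the inner product `⟨a ⊗ b, c ⊗ d⟩ = ⟨a, c⟩ ⟨b, d⟩`. -/
def HTensor (E : Type u) (F : Type v) [NormedAddCommGroup E] [InnerProductSpace ℂ E]
    [NormedAddCommGroup F] [InnerProductSpace ℂ F] : Type (max u v) :=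
  UniformSpace.Completion (E ⊗[ℂ] F)

/-- The threefold Hilbert space tensor product. -/
def HTensor3 (E : Type u) (F : Type v) (G : Type w)
    [NormedAddCommGroup E] [InnerProductSpace ℂ E]
    [NormedAddCommGroup F] [InnerProductSpace ℂ F]
    [NormedAddCommGroup G] [InnerProductSpace ℂ G] : Type (max u v w) :=
  UniformSpace.Completion (E ⊗[ℂ] F ⊗[ℂ] G)

variable {E : Type u} {F : Type v} {G : Type w}
  [NormedAddCommGroup E] [InnerProductSpace ℂ E]
  [NormedAddCommGroup F] [InnerProductSpace ℂ F]
  [NormedAddCommGroup G] [InnerProductSpace ℂ G]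

instance : NormedAddCommGroup (HTensor E F) :=
  inferInstanceAs (NormedAddCommGroup (UniformSpace.Completion (E ⊗[ℂ] F)))

instance : InnerProductSpace ℂ (HTensor E F) :=
  inferInstanceAs (InnerProductSpace ℂ (UniformSpace.Completion (E ⊗[ℂ] F)))

instance : CompleteSpace (HTensor E F) :=
  inferInstanceAs (CompleteSpace (UniformSpace.Completion (E ⊗[ℂ] F)))

instance : NormedAddCommGroup (HTensor3 E F G) :=
  inferInstanceAs (NormedAddCommGroup (UniformSpace.Completion (E ⊗[ℂ] F ⊗[ℂ] G)))

instance : InnerProductSpace ℂ (HTensor3 E F G) :=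
  inferInstanceAs (InnerProductSpace ℂ (UniformSpace.Completion (E ⊗[ℂ] F ⊗[ℂ] G)))

instance : CompleteSpace (HTensor3 E F G) :=
  inferInstanceAs (CompleteSpace (UniformSpace.Completion (E ⊗[ℂ] F ⊗[ℂ] G)))

/-- The elementary tensor `x ⊗ y`. -/
def pure2 (x : E) (y : F) : HTensor E F :=
  ((x ⊗ₜ[ℂ] y : E ⊗[ℂ] F) : UniformSpace.Completion (E ⊗[ℂ] F))

/-- The elementary tensor `x ⊗ y ⊗ z`. -/
def pure3 (x : E) (y : F) (z : G) : HTensor3 E F G :=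
  (((x ⊗ₜ[ℂ] y) ⊗ₜ[ℂ] z : E ⊗[ℂ] F ⊗[ℂ] G) : UniformSpace.Completion (E ⊗[ℂ] F ⊗[ℂ] G))

/-- The tensor product `A ⊗ B` of bounded operators, as a bounded operator on `E ⊗ F`. -/
def opTensor (A : E →L[ℂ] E) (B : F →L[ℂ] F) : HTensor E F →L[ℂ] HTensor E F :=
  (TensorProduct.mapL A B).completion

variable (E) in
/-- The permutation operator `x ⊗ y ↦ y ⊗ x` on `E ⊗ E`. -/
def swap : HTensor E E →L[ℂ] HTensor E E :=
  ((TensorProduct.commIsometry ℂ E E : E ⊗[ℂ] E ≃L[ℂ] E ⊗[ℂ] E) :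
    E ⊗[ℂ] E →L[ℂ] E ⊗[ℂ] E).completion

/-- `S = tr⁽¹⁾[T]`: the operator `S` on `F ⊗ G` is the partial trace of `T` over the first factor
of `E ⊗ F ⊗ G`. (A bounded operator is determined by its matrix elements between elementary
tensors.) -/
def IsPartialTrace1 (T : HTensor3 E F G →L[ℂ] HTensor3 E F G)
    (S : HTensor F G →L[ℂ] HTensor F G) : Prop :=
  ∀ (ι : Type u) (e : HilbertBasis ι ℂ E) (y y' : F) (z z' : G),
    HasSum (fun i => ⟪pure3 (e i) y z, T (pure3 (e i) y' z')⟫_ℂ) ⟪pure2 y z, S (pure2 y' z')⟫_ℂ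

/-- `S = tr⁽²⁾[T]`: partial trace over the second factor of `E ⊗ F ⊗ G`. -/
def IsPartialTrace2 (T : HTensor3 E F G →L[ℂ] HTensor3 E F G)
    (S : HTensor E G →L[ℂ] HTensor E G) : Prop :=
  ∀ (ι : Type v) (e : HilbertBasis ι ℂ F) (x x' : E) (z z' : G),
    HasSum (fun i => ⟪pure3 x (e i) z, T (pure3 x' (e i) z')⟫_ℂ) ⟪pure2 x z, S (pure2 x' z')⟫_ℂ

/-- `S = tr⁽³⁾[T]`: partial trace over the third factor of `E ⊗ F ⊗ G`. -/
def IsPartialTrace3 (T : HTensor3 E F G →L[ℂ] HTensor3 E F G)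
    (S : HTensor E F →L[ℂ] HTensor E F) : Prop :=
  ∀ (ι : Type w) (e : HilbertBasis ι ℂ G) (x x' : E) (y y' : F),
    HasSum (fun i => ⟪pure3 x y (e i), T (pure3 x' y' (e i))⟫_ℂ) ⟪pure2 x y, S (pure2 x' y')⟫_ℂ

end Tensor

section Source

variable {H₁ : Type u} {H₂ : Type v}
  [NormedAddCommGroup H₁] [InnerProductSpace ℂ H₁]
  [NormedAddCommGroup H₂] [InnerProductSpace ℂ H₂]

/-- `T` on `H₁ ⊗ H₁ ⊗ H₂` is a source-operator for `ρ` on `H₁ ⊗ H₂`. -/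
structure IsSourceOperator112 (ρ : HTensor H₁ H₂ →L[ℂ] HTensor H₁ H₂)
    (T : HTensor3 H₁ H₁ H₂ →L[ℂ] HTensor3 H₁ H₁ H₂) : Prop where
  isSelfAdjoint : IsSelfAdjoint T
  isTraceClass : IsTraceClass T
  partialTrace_fst : IsPartialTrace1 T ρ
  partialTrace_snd : IsPartialTrace2 T ρ

/-- `T` on `H₁ ⊗ H₂ ⊗ H₂` is a source-operator for `ρ` on `H₁ ⊗ H₂`. -/
structure IsSourceOperator122 (ρ : HTensor H₁ H₂ →L[ℂ] HTensor H₁ H₂)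
    (T : HTensor3 H₁ H₂ H₂ →L[ℂ] HTensor3 H₁ H₂ H₂) : Prop where
  isSelfAdjoint : IsSelfAdjoint T
  isTraceClass : IsTraceClass T
  partialTrace_snd : IsPartialTrace2 T ρ
  partialTrace_trd : IsPartialTrace3 T ρ

/-- A DSO state: a density operator on `H₁ ⊗ H₂` that has a density source-operator, i.e. a positive
source-operator, on `H₁ ⊗ H₁ ⊗ H₂` or on `H₁ ⊗ H₂ ⊗ H₂`. -/
structure IsDSOState (ρ : HTensor H₁ H₂ →L[ℂ] HTensor H₁ H₂) : Prop where
  isDensityOperator : IsDensityOperator ρ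
  exists_dso : (∃ T, IsSourceOperator112 ρ T ∧ T.IsPositive) ∨
    (∃ T, IsSourceOperator122 ρ T ∧ T.IsPositive)

/-- A state on `H ⊗ H` is symmetric if it is invariant under exchange of the two factors. -/
def IsSymmetricState (ρ : HTensor H₁ H₁ →L[ℂ] HTensor H₁ H₁) : Prop :=
  swap H₁ ∘L ρ ∘L swap H₁ = ρ

end Source

end QuantumDSO

end

namespace QuantumDSO

/-! ### Hilbert–Schmidt operators, cyclicity of the trace, positivity. -/

section TraceTheory

open ContinuousLinearMap
open scoped InnerProduct

/-! A positive source-operator `T` gives a positive form `Φ A B C = tr[T (A ⊗ B ⊗ C)]` in which two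
slots carry the same state: `Φ A 1 B = Φ 1 A B = tr[ρ (A ⊗ B)]`
(`IsDSOState.exists_isPositiveForm`). So `A 0` and `A 1` can be put in different slots, as if
measured jointly.

Write each observable as `P - Q` with `P, Q ≥ 0` and `P + Q = 1`. Expanding the first two slots of
`Φ` leaves four nonnegative weights of total `Φ 1 1 1 = 1`: those of `P ⊗ P'` and `Q ⊗ Q'` have
coefficient at most `|γ 0 0 + γ 1 0| + |γ 0 1 + γ 1 1|`, the mixed ones the same with minus signs
(`IsPositiveForm.norm_combination_le`). The condition on `γ` bounds both coefficients by 2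
(`abs_add_abs_le_two`). Symmetry of `ρ` exchanges the two sides, which covers the other kind of
source-operator and the other condition on `γ`. -/

lemma summable_norm_sq_iff {E : Type*} [NormedAddCommGroup E] {ι : Type*} (x : ι → E) :
    Summable (fun i => ‖x i‖ ^ 2) ↔ ∑' i, ‖x i‖ₑ ^ 2 ≠ ⊤ := by
  have : (∑' i, ‖x i‖ₑ ^ 2) = ∑' i, ((‖x i‖₊ ^ 2 : NNReal) : ENNReal) := by
    simp [enorm_eq_nnnorm]
  rw [this, ENNReal.tsum_coe_ne_top_iff_summable, ← NNReal.summable_coe]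
  simp

variable {E : Type u} [NormedAddCommGroup E] [InnerProductSpace ℂ E]

lemma hasSum_norm_inner_sq {ι : Type*} (e : HilbertBasis ι ℂ E) (x : E) :
    HasSum (fun i => ‖⟪e i, x⟫_ℂ‖ ^ 2) (‖x‖ ^ 2) := by
  have h := (e.hasSum_inner_mul_inner x x).mapL Complex.reCLM
  have h2 : Complex.reCLM ⟪x, x⟫_ℂ = ‖x‖ ^ 2 := by
    rw [inner_self_eq_norm_sq_to_K]
    simp [← Complex.ofReal_pow]
  rw [h2] at h
  convert h using 2 with i
  have h3 : (⟪x, e i⟫_ℂ * ⟪e i, x⟫_ℂ).re = ‖⟪x, e i⟫_ℂ * ⟪e i, x⟫_ℂ‖ :=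
    inner_mul_symm_re_eq_norm (𝕜 := ℂ) x (e i)
  rw [Complex.reCLM_apply, h3, norm_mul, norm_inner_symm x, sq]

lemma enorm_sq_eq_tsum {ι : Type*} (e : HilbertBasis ι ℂ E) (x : E) :
    ‖x‖ₑ ^ 2 = ∑' i, ‖⟪e i, x⟫_ℂ‖ₑ ^ 2 := by
  have h : HasSum (fun i => ‖⟪e i, x⟫_ℂ‖₊ ^ 2) (‖x‖₊ ^ 2) := by
    rw [← NNReal.hasSum_coe]
    simpa using hasSum_norm_inner_sq e x
  simpa [enorm_eq_nnnorm] using (ENNReal.hasSum_coe.2 h).tsum_eq.symm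

lemma IsHilbertSchmidt.comp_left {T : E →L[ℂ] E} (h : IsHilbertSchmidt T) (X : E →L[ℂ] E) :
    IsHilbertSchmidt (X ∘L T) := by
  intro κ f
  refine Summable.of_nonneg_of_le (fun _ => by positivity) (fun i => ?_)
    ((h κ f).mul_left (‖X‖ ^ 2))
  rw [← mul_pow]
  gcongr
  exact X.le_opNorm _

lemma IsHilbertSchmidt.summable_inner {ι κ : Type u} (e : HilbertBasis ι ℂ E)
    (f : HilbertBasis κ ℂ E) {T : E →L[ℂ] E} (h : IsHilbertSchmidt T) :
    Summable fun p : ι × κ => ‖⟪f p.2, T (e p.1)⟫_ℂ‖ ^ 2 := by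
  rw [summable_prod_of_nonneg (fun _ => by positivity)]
  refine ⟨fun i => (hasSum_norm_inner_sq f (T (e i))).summable, ?_⟩
  simp_rw [fun i => (hasSum_norm_inner_sq f (T (e i))).tsum_eq]
  exact h ι e

variable [CompleteSpace E]

/-- Both sides are the double sum of `|⟪f j, T (e i)⟫|²`. In `ENNReal` the sums may be exchanged
with no summability hypothesis. -/
lemma tsum_enorm_sq_adjoint {ι κ : Type*} (e : HilbertBasis ι ℂ E) (f : HilbertBasis κ ℂ E)
    (T : E →L[ℂ] E) :
    ∑' i, ‖T (e i)‖ₑ ^ 2 = ∑' j, ‖(T†) (f j)‖ₑ ^ 2 := by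
  simp_rw [fun i => enorm_sq_eq_tsum f (T (e i)), fun j => enorm_sq_eq_tsum e ((T†) (f j))]
  rw [ENNReal.tsum_comm]
  congr! 5 with j i
  rw [adjoint_inner_right, ← enorm_norm, ← enorm_norm ⟪T _, _⟫_ℂ, norm_inner_symm]

lemma exists_basis (E : Type u) [NormedAddCommGroup E] [InnerProductSpace ℂ E] [CompleteSpace E] :
    ∃ (ι : Type u), Nonempty (HilbertBasis ι ℂ E) := by
  obtain ⟨w, b, -⟩ := exists_hilbertBasis ℂ E
  exact ⟨w, ⟨b⟩⟩

lemma IsHilbertSchmidt.adjoint {T : E →L[ℂ] E} (h : IsHilbertSchmidt T) :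
    IsHilbertSchmidt (T†) := by
  intro κ f
  have := h κ f
  rw [summable_norm_sq_iff] at this ⊢
  rwa [← tsum_enorm_sq_adjoint f f]

lemma IsHilbertSchmidt.comp_right {T : E →L[ℂ] E} (h : IsHilbertSchmidt T) (X : E →L[ℂ] E) :
    IsHilbertSchmidt (T ∘L X) := by
  have := (h.adjoint.comp_left (X†)).adjoint
  rwa [← adjoint_comp, adjoint_adjoint] at this

lemma IsTraceClass.comp_right {T : E →L[ℂ] E} (h : IsTraceClass T) (X : E →L[ℂ] E) :
    IsTraceClass (T ∘L X) := by
  obtain ⟨A, B, hA, hB, rfl⟩ := h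
  exact ⟨A, B ∘L X, hA, hB.comp_right X, rfl⟩

lemma IsTraceClass.summable {ι : Type u} (e : HilbertBasis ι ℂ E) {T : E →L[ℂ] E}
    (h : IsTraceClass T) : Summable fun i => ⟪e i, T (e i)⟫_ℂ := by
  obtain ⟨A, B, hA, hB, rfl⟩ := h
  refine Summable.of_norm_bounded ((hA.adjoint ι e).add (hB ι e)) (fun i => ?_)
  rw [comp_apply, ← adjoint_inner_left]
  refine (norm_inner_le_norm _ _).trans ?_
  nlinarith [sq_nonneg (‖(A†) (e i)‖ - ‖B (e i)‖), sq_nonneg (‖(A†) (e i)‖), sq_nonneg ‖B (e i)‖]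

lemma summable_inner_mul_inner_of_isHilbertSchmidt {ι κ : Type u} (e : HilbertBasis ι ℂ E)
    (f : HilbertBasis κ ℂ E) {A B : E →L[ℂ] E} (hA : IsHilbertSchmidt A)
    (hB : IsHilbertSchmidt B) :
    Summable fun p : ι × κ => ⟪(A†) (e p.1), f p.2⟫_ℂ * ⟪f p.2, B (e p.1)⟫_ℂ := by
  refine Summable.of_norm_bounded ((hA.adjoint.summable_inner e f).add (hB.summable_inner e f))
    (fun p => ?_)
  rw [norm_mul, norm_inner_symm]
  generalize ‖⟪f p.2, (A†) (e p.1)⟫_ℂ‖ = a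
  generalize ‖⟪f p.2, B (e p.1)⟫_ℂ‖ = b
  nlinarith [sq_nonneg (a - b), sq_nonneg a, sq_nonneg b]

/-- Inserting the basis `f` between the factors gives an absolutely summable double series. Allowing
two different bases yields cyclicity and basis independence at once. -/
lemma tsum_inner_comp_comm {ι κ : Type u} (e : HilbertBasis ι ℂ E) (f : HilbertBasis κ ℂ E)
    {A B : E →L[ℂ] E} (hA : IsHilbertSchmidt A) (hB : IsHilbertSchmidt B) :
    ∑' i, ⟪e i, (A ∘L B) (e i)⟫_ℂ = ∑' j, ⟪f j, (B ∘L A) (f j)⟫_ℂ := by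
  have hs := summable_inner_mul_inner_of_isHilbertSchmidt e f hA hB
  calc ∑' i, ⟪e i, (A ∘L B) (e i)⟫_ℂ
      = ∑' i, ∑' j, ⟪(A†) (e i), f j⟫_ℂ * ⟪f j, B (e i)⟫_ℂ := by
        refine tsum_congr fun i => ?_
        rw [f.tsum_inner_mul_inner, comp_apply, adjoint_inner_left]
    _ = ∑' j, ∑' i, ⟪(A†) (e i), f j⟫_ℂ * ⟪f j, B (e i)⟫_ℂ :=
        hs.tsum_comm.symm
    _ = ∑' j, ⟪f j, (B ∘L A) (f j)⟫_ℂ := by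
        refine tsum_congr fun j => ?_
        rw [comp_apply, ← adjoint_inner_left, ← e.tsum_inner_mul_inner]
        refine tsum_congr fun i => ?_
        rw [mul_comm, adjoint_inner_left, adjoint_inner_left]

lemma IsTraceClass.hasSum_trace {ι : Type u} (e : HilbertBasis ι ℂ E) {T : E →L[ℂ] E}
    (h : IsTraceClass T) : HasSum (fun i => ⟪e i, T (e i)⟫_ℂ) (trace T) := by
  have hs := (h.summable e).hasSum
  obtain ⟨A, B, hA, hB, rfl⟩ := h
  convert hs using 1
  -- Cyclicity passes from the chosen basis to `e`, and a second use, within `e`, restores the order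
  -- of the factors.
  rw [trace, tsum_inner_comp_comm _ e hA hB, ← tsum_inner_comp_comm e e hA hB]

lemma trace_comp_comm {A B : E →L[ℂ] E} (hA : IsHilbertSchmidt A) (hB : IsHilbertSchmidt B) :
    trace (A ∘L B) = trace (B ∘L A) :=
  tsum_inner_comp_comm _ _ hA hB

lemma IsTraceClass.trace_comp_add {T : E →L[ℂ] E} (h : IsTraceClass T) (X Y : E →L[ℂ] E) :
    trace (T ∘L (X + Y)) = trace (T ∘L X) + trace (T ∘L Y) := by
  obtain ⟨ι, ⟨e⟩⟩ := exists_basis E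
  refine ((h.comp_right _).hasSum_trace e).unique ?_
  convert ((h.comp_right X).hasSum_trace e).add ((h.comp_right Y).hasSum_trace e) using 2 with i
  simp

/-- By cyclicity the trace is that of `R T R`, whose diagonal entries `⟪R eᵢ, T (R eᵢ)⟫` are
nonnegative reals. -/
lemma IsTraceClass.trace_comp_nonneg {T : E →L[ℂ] E} (h : IsTraceClass T) (hT : T.IsPositive)
    {R : E →L[ℂ] E} (hR : IsSelfAdjoint R) :
    ∃ r : ℝ, 0 ≤ r ∧ trace (T ∘L R ∘L R) = r := by
  have h1 : trace (T ∘L R ∘L R) = trace ((R ∘L T) ∘L R) := by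
    obtain ⟨A, B, hA, hB, rfl⟩ := h
    -- Cyclicity is available for two Hilbert–Schmidt factors, hence two rotations: `A (B R R)` to
    -- `(B R) (R A)` to `(R A) (B R)`.
    have e1 : (A ∘L B) ∘L R ∘L R = A ∘L (B ∘L R ∘L R) := rfl
    have e2 : (B ∘L R ∘L R) ∘L A = (B ∘L R) ∘L (R ∘L A) := rfl
    rw [e1, trace_comp_comm hA (hB.comp_right _), e2,
      trace_comp_comm (hB.comp_right _) (hA.comp_left _)]
    rfl
  obtain ⟨ι, ⟨e⟩⟩ := exists_basis E
  have h2 : IsTraceClass ((R ∘L T) ∘L R) := by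
    obtain ⟨A, B, hA, hB, rfl⟩ := h
    exact ⟨R ∘L A, B ∘L R, hA.comp_left R, hB.comp_right R, rfl⟩
  have h3 := h2.hasSum_trace e
  have h4 : ∀ i, ⟪e i, ((R ∘L T) ∘L R) (e i)⟫_ℂ = ((T.reApplyInnerSelf (R (e i)) : ℝ) : ℂ) := by
    intro i
    have : ⟪e i, ((R ∘L T) ∘L R) (e i)⟫_ℂ = ⟪R (e i), T (R (e i))⟫_ℂ := by
      simp only [comp_apply]
      conv_lhs => rw [← hR.adjoint_eq, adjoint_inner_right, hR.adjoint_eq]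
    rw [this, reApplyInnerSelf_apply, ← hT.isSelfAdjoint.adjoint_eq, adjoint_inner_right,
      hT.isSelfAdjoint.adjoint_eq]
    have h5 := hT.inner_nonneg_left (R (e i))
    exact (Complex.conj_eq_iff_re.1 (Complex.conj_eq_iff_im.2 (Complex.nonneg_iff.1 h5).2.symm)).symm
  simp_rw [h4] at h3
  refine ⟨(trace ((R ∘L T) ∘L R)).re, ?_, ?_⟩
  · have := h3.mapL Complex.reCLM
    exact this.nonneg fun i => hT.re_inner_nonneg_left _
  · have h5 := h3.mapL Complex.imCLM
    have h6 : (trace ((R ∘L T) ∘L R)).im = 0 := h5.unique (by simp)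
    rw [h1]
    exact Complex.ext rfl (by simpa using h6)

end TraceTheory

end QuantumDSO

namespace QuantumDSO

/-! ### Operators and dense spans in completions. -/

section Completion

open UniformSpace

variable {X : Type*} [NormedAddCommGroup X] [InnerProductSpace ℂ X]

lemma completion_add (f g : X →L[ℂ] X) :
    (f + g).completion = f.completion + g.completion := by
  refine ContinuousLinearMap.ext fun x => ?_
  induction x using Completion.induction_on with
  | hp => exact isClosed_eq (by fun_prop) (by fun_prop)
  | ih a => simp [Completion.coe_add]

lemma completion_comp (f g : X →L[ℂ] X) :
    (f ∘L g).completion = f.completion ∘L g.completion := by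
  refine ContinuousLinearMap.ext fun x => ?_
  induction x using Completion.induction_on with
  | hp => exact isClosed_eq (by fun_prop) (by fun_prop)
  | ih a => simp

/-- The hypothesis is symmetry on `X`, which need not be complete and so may lack adjoints. -/
lemma isSelfAdjoint_completion {f : X →L[ℂ] X} (hf : ∀ x y, ⟪f x, y⟫_ℂ = ⟪x, f y⟫_ℂ) :
    IsSelfAdjoint f.completion := by
  rw [ContinuousLinearMap.isSelfAdjoint_iff_isSymmetric]
  intro x y
  induction x, y using Completion.induction_on₂ with
  | hp => exact isClosed_eq (by fun_prop) (by fun_prop)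
  | ih a b => simp [hf]

lemma dense_span_completion {ι : Type*} {v : ι → X}
    (hv : ⊤ ≤ (Submodule.span ℂ (Set.range v)).topologicalClosure) :
    ⊤ ≤ (Submodule.span ℂ
      (Set.range fun i => (v i : Completion X))).topologicalClosure := by
  set S := (Submodule.span ℂ (Set.range fun i => (v i : Completion X))).topologicalClosure
  have hS : IsClosed (S : Set (Completion X)) := Submodule.isClosed_topologicalClosure _
  have h : (Submodule.span ℂ (Set.range v)).topologicalClosure ≤
      S.comap (Completion.toComplL : X →L[ℂ] Completion X).toLinearMap := by
    refine Submodule.topologicalClosure_minimal _ (Submodule.span_le.2 ?_)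
      (hS.preimage (Completion.continuous_coe X))
    rintro _ ⟨i, rfl⟩
    exact Submodule.le_topologicalClosure _ (Submodule.subset_span ⟨i, rfl⟩)
  have h' : ∀ x, x ∈ S := fun x => by
    induction x using Completion.induction_on with
    | hp => exact hS
    | ih a => exact h (hv trivial)
  exact fun x _ => h' x

end Completion

/-! ### Density and symmetry in algebraic tensor products. -/

section DenseTensor

variable {X Y : Type*} [NormedAddCommGroup X] [InnerProductSpace ℂ X]
  [NormedAddCommGroup Y] [InnerProductSpace ℂ Y]

/-- Density is extended one factor at a time, since `x ↦ x ⊗ w j` and then `y ↦ x ⊗ y` are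
continuous and linear. -/
lemma dense_span_tmul {ι κ : Type*} {v : ι → X} {w : κ → Y}
    (hv : ⊤ ≤ (Submodule.span ℂ (Set.range v)).topologicalClosure)
    (hw : ⊤ ≤ (Submodule.span ℂ (Set.range w)).topologicalClosure) :
    ⊤ ≤ (Submodule.span ℂ
      (Set.range fun p : ι × κ => v p.1 ⊗ₜ[ℂ] w p.2)).topologicalClosure := by
  set S := (Submodule.span ℂ (Set.range fun p : ι × κ => v p.1 ⊗ₜ[ℂ] w p.2)).topologicalClosure
  have hS : IsClosed (S : Set (X ⊗[ℂ] Y)) := Submodule.isClosed_topologicalClosure _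
  have h1 : ∀ j, (Submodule.span ℂ (Set.range v)).topologicalClosure ≤
      S.comap ((TensorProduct.mkL ℂ X Y).flip (w j)).toLinearMap := by
    intro j
    refine Submodule.topologicalClosure_minimal _ (Submodule.span_le.2 ?_)
      (hS.preimage ((TensorProduct.mkL ℂ X Y).flip (w j)).continuous)
    rintro _ ⟨i, rfl⟩
    exact Submodule.le_topologicalClosure _ (Submodule.subset_span ⟨(i, j), rfl⟩)
  have h2 : ∀ x, (Submodule.span ℂ (Set.range w)).topologicalClosure ≤
      S.comap (TensorProduct.mkL ℂ X Y x).toLinearMap := by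
    intro x
    refine Submodule.topologicalClosure_minimal _ (Submodule.span_le.2 ?_)
      (hS.preimage (TensorProduct.mkL ℂ X Y x).continuous)
    rintro _ ⟨j, rfl⟩
    exact h1 j (hv trivial : x ∈ _)
  intro t _
  induction t using TensorProduct.induction_on with
  | zero => exact S.zero_mem
  | tmul x y => exact h2 x (hw trivial : y ∈ _)
  | add a b ha hb => exact S.add_mem (ha trivial) (hb trivial)

lemma inner_mapL_comm {A : X →L[ℂ] X} {B : Y →L[ℂ] Y}
    (hA : ∀ x y, ⟪A x, y⟫_ℂ = ⟪x, A y⟫_ℂ) (hB : ∀ x y, ⟪B x, y⟫_ℂ = ⟪x, B y⟫_ℂ)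
    (s t : X ⊗[ℂ] Y) :
    ⟪TensorProduct.mapL A B s, t⟫_ℂ = ⟪s, TensorProduct.mapL A B t⟫_ℂ := by
  induction s using TensorProduct.induction_on with
  | zero => simp
  | add a b ha hb => rw [map_add, inner_add_left, ha, hb, inner_add_left]
  | tmul x y =>
    induction t using TensorProduct.induction_on with
    | zero => simp
    | add a b ha hb => rw [map_add, inner_add_right, ha, hb, inner_add_right]
    | tmul x' y' => simp [hA, hB]

end DenseTensor

/-! ### Product bases and tensor products of operators. -/

section Bases

variable {E : Type u} {F : Type v} {G : Type w}
  [NormedAddCommGroup E] [InnerProductSpace ℂ E]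
  [NormedAddCommGroup F] [InnerProductSpace ℂ F]
  [NormedAddCommGroup G] [InnerProductSpace ℂ G]

lemma orthonormal_completion {X ι : Type*} [NormedAddCommGroup X] [InnerProductSpace ℂ X]
    {v : ι → X} (hv : Orthonormal ℂ v) :
    Orthonormal ℂ fun i => (v i : UniformSpace.Completion X) := by
  classical
  rw [orthonormal_iff_ite] at hv ⊢
  simpa using hv

lemma orthonormal_pure2 {ι κ : Type*} {e : ι → E} {f : κ → F} (he : Orthonormal ℂ e)
    (hf : Orthonormal ℂ f) : Orthonormal ℂ fun p : ι × κ => pure2 (e p.1) (f p.2) :=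
  orthonormal_completion (he.tmul hf)

lemma dense_span_pure2 {ι κ : Type*} {e : ι → E} {f : κ → F}
    (he : ⊤ ≤ (Submodule.span ℂ (Set.range e)).topologicalClosure)
    (hf : ⊤ ≤ (Submodule.span ℂ (Set.range f)).topologicalClosure) :
    ⊤ ≤ (Submodule.span ℂ
      (Set.range fun p : ι × κ => pure2 (e p.1) (f p.2))).topologicalClosure :=
  dense_span_completion (dense_span_tmul he hf)

lemma orthonormal_pure3 {ι κ μ : Type*} {e : ι → E} {f : κ → F} {g : μ → G}
    (he : Orthonormal ℂ e) (hf : Orthonormal ℂ f) (hg : Orthonormal ℂ g) :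
    Orthonormal ℂ fun p : (ι × κ) × μ => pure3 (e p.1.1) (f p.1.2) (g p.2) := by
  have h := he.tmul hf
  exact orthonormal_completion (h.tmul hg)

lemma dense_span_pure3 {ι κ μ : Type*} {e : ι → E} {f : κ → F} {g : μ → G}
    (he : ⊤ ≤ (Submodule.span ℂ (Set.range e)).topologicalClosure)
    (hf : ⊤ ≤ (Submodule.span ℂ (Set.range f)).topologicalClosure)
    (hg : ⊤ ≤ (Submodule.span ℂ (Set.range g)).topologicalClosure) :
    ⊤ ≤ (Submodule.span ℂ (Set.range fun p : (ι × κ) × μ =>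
      pure3 (e p.1.1) (f p.1.2) (g p.2))).topologicalClosure := by
  have h := dense_span_completion (dense_span_tmul (dense_span_tmul he hf) hg)
  have h' : (Submodule.span ℂ (Set.range fun p : (ι × κ) × μ =>
      pure3 (e p.1.1) (f p.1.2) (g p.2))).topologicalClosure = ⊤ := top_unique h
  exact h'.ge

/-- The product basis `eᵢ ⊗ fⱼ` of `E ⊗ F`. -/
noncomputable def basis2 {ι κ : Type*} (e : HilbertBasis ι ℂ E) (f : HilbertBasis κ ℂ F) :
    HilbertBasis (ι × κ) ℂ (HTensor E F) :=
  HilbertBasis.mk (orthonormal_pure2 e.orthonormal f.orthonormal)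
    (dense_span_pure2 e.dense_span.ge f.dense_span.ge)

lemma basis2_apply {ι κ : Type*} (e : HilbertBasis ι ℂ E) (f : HilbertBasis κ ℂ F) (p : ι × κ) :
    basis2 e f p = pure2 (e p.1) (f p.2) := by
  rw [basis2, HilbertBasis.coe_mk]

/-- The product basis `eᵢ ⊗ fⱼ ⊗ gₖ` of `E ⊗ F ⊗ G`. -/
noncomputable def basis3 {ι κ μ : Type*} (e : HilbertBasis ι ℂ E) (f : HilbertBasis κ ℂ F)
    (g : HilbertBasis μ ℂ G) : HilbertBasis ((ι × κ) × μ) ℂ (HTensor3 E F G) :=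
  HilbertBasis.mk (orthonormal_pure3 e.orthonormal f.orthonormal g.orthonormal)
    (dense_span_pure3 e.dense_span.ge f.dense_span.ge g.dense_span.ge)

lemma basis3_apply {ι κ μ : Type*} (e : HilbertBasis ι ℂ E) (f : HilbertBasis κ ℂ F)
    (g : HilbertBasis μ ℂ G) (p : (ι × κ) × μ) :
    basis3 e f g p = pure3 (e p.1.1) (f p.1.2) (g p.2) := by
  rw [basis3, HilbertBasis.coe_mk]

lemma opTensor_pure2 (A : E →L[ℂ] E) (B : F →L[ℂ] F) (x : E) (y : F) :
    opTensor A B (pure2 x y) = pure2 (A x) (B y) :=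
  (ContinuousLinearMap.completion_apply_coe _ _).trans rfl

/-- The tensor product `A ⊗ B ⊗ C` of bounded operators. -/
noncomputable def opTensor3 (A : E →L[ℂ] E) (B : F →L[ℂ] F) (C : G →L[ℂ] G) :
    HTensor3 E F G →L[ℂ] HTensor3 E F G :=
  (TensorProduct.mapL (TensorProduct.mapL A B) C).completion

lemma opTensor3_pure3 (A : E →L[ℂ] E) (B : F →L[ℂ] F) (C : G →L[ℂ] G) (x : E) (y : F) (z : G) :
    opTensor3 A B C (pure3 x y z) = pure3 (A x) (B y) (C z) :=
  (ContinuousLinearMap.completion_apply_coe _ _).trans rfl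

lemma opTensor3_add_left (A A' : E →L[ℂ] E) (B : F →L[ℂ] F) (C : G →L[ℂ] G) :
    opTensor3 (A + A') B C = opTensor3 A B C + opTensor3 A' B C := by
  rw [opTensor3, TensorProduct.mapL_add_left, TensorProduct.mapL_add_left]
  exact completion_add _ _

lemma opTensor3_add_mid (A : E →L[ℂ] E) (B B' : F →L[ℂ] F) (C : G →L[ℂ] G) :
    opTensor3 A (B + B') C = opTensor3 A B C + opTensor3 A B' C := by
  rw [opTensor3, TensorProduct.mapL_add_right, TensorProduct.mapL_add_left]
  exact completion_add _ _

lemma opTensor3_add_right (A : E →L[ℂ] E) (B : F →L[ℂ] F) (C C' : G →L[ℂ] G) :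
    opTensor3 A B (C + C') = opTensor3 A B C + opTensor3 A B C' := by
  rw [opTensor3, TensorProduct.mapL_add_right]
  exact completion_add _ _

lemma opTensor3_comp (A A' : E →L[ℂ] E) (B B' : F →L[ℂ] F) (C C' : G →L[ℂ] G) :
    opTensor3 (A ∘L A') (B ∘L B') (C ∘L C') = opTensor3 A B C ∘L opTensor3 A' B' C' := by
  rw [opTensor3, TensorProduct.mapL_comp, TensorProduct.mapL_comp]
  exact completion_comp _ _

lemma isSelfAdjoint_opTensor3 [CompleteSpace E] [CompleteSpace F] [CompleteSpace G]
    {A : E →L[ℂ] E} {B : F →L[ℂ] F} {C : G →L[ℂ] G}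
    (hA : IsSelfAdjoint A) (hB : IsSelfAdjoint B) (hC : IsSelfAdjoint C) :
    IsSelfAdjoint (opTensor3 A B C) :=
  isSelfAdjoint_completion (inner_mapL_comm (inner_mapL_comm hA.isSymmetric hB.isSymmetric)
    hC.isSymmetric)

lemma swap_pure2 (x y : E) : swap E (pure2 x y) = pure2 y x :=
  (ContinuousLinearMap.completion_apply_coe _ _).trans rfl

lemma isSelfAdjoint_swap : IsSelfAdjoint (swap E) := by
  refine isSelfAdjoint_completion fun x y => ?_
  have h := (TensorProduct.commIsometry ℂ E E).inner_map_map x (TensorProduct.commIsometry ℂ E E y)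
  have h2 : TensorProduct.commIsometry ℂ E E (TensorProduct.commIsometry ℂ E E y) = y := by
    simp
  rw [h2] at h
  exact h

end Bases

/-! ### Partial traces and the trilinear trace form. -/

section PartialTrace

variable {H : Type u} [NormedAddCommGroup H] [InnerProductSpace ℂ H]
  {ρ : HTensor H H →L[ℂ] HTensor H H} {T : HTensor3 H H H →L[ℂ] HTensor3 H H H}

lemma hasSum_trace_comp_opTensor (hρ : IsTraceClass ρ) {ι : Type u} (e : HilbertBasis ι ℂ H)
    (A B : H →L[ℂ] H) :
    HasSum (fun p : ι × ι => ⟪pure2 (e p.1) (e p.2), ρ (pure2 (A (e p.1)) (B (e p.2)))⟫_ℂ)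
      (trace (ρ ∘L opTensor A B)) := by
  simpa only [basis2_apply, ContinuousLinearMap.comp_apply, opTensor_pure2] using
    (hρ.comp_right (opTensor A B)).hasSum_trace (basis2 e e)

lemma hasSum_trace_comp_opTensor3 (hT : IsTraceClass T) {ι : Type u} (e : HilbertBasis ι ℂ H)
    (A B C : H →L[ℂ] H) :
    HasSum (fun p : (ι × ι) × ι => ⟪pure3 (e p.1.1) (e p.1.2) (e p.2),
      T (pure3 (A (e p.1.1)) (B (e p.1.2)) (C (e p.2)))⟫_ℂ)
      (trace (T ∘L opTensor3 A B C)) := by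
  simpa only [basis3_apply, ContinuousLinearMap.comp_apply, opTensor3_pure3] using
    (hT.comp_right (opTensor3 A B C)).hasSum_trace (basis3 e e e)

/-- The form `(A, B, C) ↦ tr[T (A ⊗ B ⊗ C)]` of a trace class operator. -/
noncomputable def traceForm (hT : IsTraceClass T) :
    (H →L[ℂ] H) →+ (H →L[ℂ] H) →+ (H →L[ℂ] H) →+ ℂ :=
  AddMonoidHom.mk' (fun A => AddMonoidHom.mk' (fun B => AddMonoidHom.mk'
    (fun C => trace (T ∘L opTensor3 A B C))
    (fun C C' => by rw [opTensor3_add_right, hT.trace_comp_add]))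
    (fun B B' => by
      ext C
      exact (congrArg _ (congrArg _ (opTensor3_add_mid A B B' C))).trans
        (hT.trace_comp_add _ _)))
    (fun A A' => by
      ext B C
      exact (congrArg _ (congrArg _ (opTensor3_add_left A A' B C))).trans
        (hT.trace_comp_add _ _))

lemma traceForm_apply (hT : IsTraceClass T) (A B C : H →L[ℂ] H) :
    traceForm hT A B C = trace (T ∘L opTensor3 A B C) := rfl

variable [CompleteSpace H]

/-- In a product basis, summing first over the traced-out index turns the matrix elements of `T`
into those of `ρ`. -/
lemma IsPartialTrace1.trace_eq (h : IsPartialTrace1 T ρ) (hT : IsTraceClass T)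
    (hρ : IsTraceClass ρ) (A B : H →L[ℂ] H) :
    trace (T ∘L opTensor3 1 A B) = trace (ρ ∘L opTensor A B) := by
  obtain ⟨ι, ⟨e⟩⟩ := exists_basis H
  -- The traced-out index moves to the last place, where `prod_fiberwise` sums it first.
  let σ : (ι × ι) × ι ≃ (ι × ι) × ι :=
    ⟨fun p => ((p.2, p.1.1), p.1.2), fun p => ((p.1.2, p.2), p.1.1), fun _ => rfl, fun _ => rfl⟩
  have h3 : HasSum (fun p : (ι × ι) × ι => ⟪pure3 (e p.2) (e p.1.1) (e p.1.2),
      T (pure3 (e p.2) (A (e p.1.1)) (B (e p.1.2)))⟫_ℂ) (trace (T ∘L opTensor3 1 A B)) :=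
    σ.hasSum_iff.2 (hasSum_trace_comp_opTensor3 hT e 1 A B)
  have h2 := h3.prod_fiberwise fun p =>
    h ι e (e p.1) (A (e p.1)) (e p.2) (B (e p.2))
  exact h2.unique (hasSum_trace_comp_opTensor hρ e A B)

lemma IsPartialTrace2.trace_eq (h : IsPartialTrace2 T ρ) (hT : IsTraceClass T)
    (hρ : IsTraceClass ρ) (A B : H →L[ℂ] H) :
    trace (T ∘L opTensor3 A 1 B) = trace (ρ ∘L opTensor A B) := by
  obtain ⟨ι, ⟨e⟩⟩ := exists_basis H
  let σ : (ι × ι) × ι ≃ (ι × ι) × ι :=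
    ⟨fun p => ((p.1.1, p.2), p.1.2), fun p => ((p.1.1, p.2), p.1.2), fun _ => rfl, fun _ => rfl⟩
  have h3 : HasSum (fun p : (ι × ι) × ι => ⟪pure3 (e p.1.1) (e p.2) (e p.1.2),
      T (pure3 (A (e p.1.1)) (e p.2) (B (e p.1.2)))⟫_ℂ) (trace (T ∘L opTensor3 A 1 B)) :=
    σ.hasSum_iff.2 (hasSum_trace_comp_opTensor3 hT e A 1 B)
  have h2 := h3.prod_fiberwise fun p =>
    h ι e (e p.1) (A (e p.1)) (e p.2) (B (e p.2))
  exact h2.unique (hasSum_trace_comp_opTensor hρ e A B)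

lemma IsPartialTrace3.trace_eq (h : IsPartialTrace3 T ρ) (hT : IsTraceClass T)
    (hρ : IsTraceClass ρ) (A B : H →L[ℂ] H) :
    trace (T ∘L opTensor3 A B 1) = trace (ρ ∘L opTensor A B) := by
  obtain ⟨ι, ⟨e⟩⟩ := exists_basis H
  have h3 : HasSum (fun p : (ι × ι) × ι => ⟪pure3 (e p.1.1) (e p.1.2) (e p.2),
      T (pure3 (A (e p.1.1)) (B (e p.1.2)) (e p.2))⟫_ℂ) (trace (T ∘L opTensor3 A B 1)) :=
    hasSum_trace_comp_opTensor3 hT e A B 1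
  have h2 := h3.prod_fiberwise fun p =>
    h ι e (e p.1) (A (e p.1)) (e p.2) (B (e p.2))
  exact h2.unique (hasSum_trace_comp_opTensor hρ e A B)

lemma IsSymmetricState.trace_comp_opTensor_comm (hs : IsSymmetricState ρ) (hρ : IsTraceClass ρ)
    (A B : H →L[ℂ] H) : trace (ρ ∘L opTensor A B) = trace (ρ ∘L opTensor B A) := by
  obtain ⟨ι, ⟨e⟩⟩ := exists_basis H
  refine (hasSum_trace_comp_opTensor hρ e A B).unique ?_
  convert (Equiv.prodComm ι ι).hasSum_iff.2 (hasSum_trace_comp_opTensor hρ e B A) using 2 with p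
  have h : ∀ a b c d : H, ⟪pure2 a b, ρ (pure2 c d)⟫_ℂ = ⟪pure2 b a, ρ (pure2 d c)⟫_ℂ := by
    intro a b c d
    conv_lhs => rw [← show swap H ∘L ρ ∘L swap H = ρ from hs]
    rw [ContinuousLinearMap.comp_apply, ContinuousLinearMap.comp_apply, swap_pure2,
      ← ContinuousLinearMap.adjoint_inner_left, isSelfAdjoint_swap.adjoint_eq, swap_pure2]
  exact h _ _ _ _

/-- With square roots `R`, `S`, `Q`, the operator `A ⊗ B ⊗ C` is the square of the self-adjoint `R ⊗
S ⊗ Q`. -/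
lemma traceForm_nonneg (hT : IsTraceClass T) (hT' : T.IsPositive) {A B C : H →L[ℂ] H}
    (hA : 0 ≤ A) (hB : 0 ≤ B) (hC : 0 ≤ C) :
    ∃ r : ℝ, 0 ≤ r ∧ traceForm hT A B C = r := by
  have key : ∀ {A : H →L[ℂ] H}, 0 ≤ A → ∃ R : H →L[ℂ] H, IsSelfAdjoint R ∧ A = R ∘L R :=
    fun {A} hA => ⟨CFC.sqrt A, (CFC.sqrt_nonneg A).isSelfAdjoint,
      (CFC.sqrt_mul_sqrt_self A hA).symm⟩
  obtain ⟨R, hR, rfl⟩ := key hA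
  obtain ⟨S, hS, rfl⟩ := key hB
  obtain ⟨Q, hQ, rfl⟩ := key hC
  rw [traceForm_apply, opTensor3_comp]
  exact hT.trace_comp_nonneg hT' (isSelfAdjoint_opTensor3 hR hS hQ)

end PartialTrace

end QuantumDSO

namespace QuantumDSO

/-! ### The Bell-type inequality for positive forms. -/

section Bell

/-- Expanding `(1 - x)(1 - y) ≥ 0` and `(1 + x)(1 + y) ≥ 0` gives `|x + y| ≤ 1 + x y`. Adding the
same bound for `z, w` cancels the products. -/
lemma abs_add_abs_le_two {x y z w : ℝ} (hx : |x| ≤ 1) (hy : |y| ≤ 1) (hz : |z| ≤ 1)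
    (hw : |w| ≤ 1) (h : x * y = -(z * w)) : |x + y| + |z + w| ≤ 2 := by
  rw [abs_le] at hx hy hz hw
  have h1 : |x + y| ≤ 1 + x * y := by
    rw [abs_le]
    constructor <;> nlinarith [mul_nonneg (sub_nonneg.2 hx.2) (sub_nonneg.2 hy.2),
      mul_nonneg (neg_le_iff_add_nonneg.1 hx.1) (neg_le_iff_add_nonneg.1 hy.1)]
  have h2 : |z + w| ≤ 1 + z * w := by
    rw [abs_le]
    constructor <;> nlinarith [mul_nonneg (sub_nonneg.2 hz.2) (sub_nonneg.2 hw.2),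
      mul_nonneg (neg_le_iff_add_nonneg.1 hz.1) (neg_le_iff_add_nonneg.1 hw.1)]
  linarith

variable {M : Type*} [Ring M] [PartialOrder M]

/-- A positive triadditive form. -/
def IsPositiveForm (Φ : M →+ M →+ M →+ ℂ) : Prop :=
  ∀ a b c, 0 ≤ a → 0 ≤ b → 0 ≤ c → ∃ r : ℝ, 0 ≤ r ∧ Φ a b c = r

/-- `a` is a difference of two positive elements with sum `1`. -/
def IsPositiveSplit (a p q : M) : Prop := 0 ≤ p ∧ 0 ≤ q ∧ a = p - q ∧ 1 = p + q

lemma IsPositiveForm.norm_le {Φ : M →+ M →+ M →+ ℂ} (hΦ : IsPositiveForm Φ) {a b c p q : M}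
    (ha : 0 ≤ a) (hb : 0 ≤ b) (hc : IsPositiveSplit c p q) : ‖Φ a b c‖ ≤ (Φ a b 1).re := by
  obtain ⟨hp, hq, rfl, h1⟩ := hc
  obtain ⟨r, hr, hr'⟩ := hΦ a b p ha hb hp
  obtain ⟨s, hs, hs'⟩ := hΦ a b q ha hb hq
  rw [h1, map_sub, map_add, hr', hs', ← Complex.ofReal_sub, ← Complex.ofReal_add, Complex.norm_real,
    Complex.ofReal_re, Real.norm_eq_abs, abs_le]
  constructor <;> linarith

/-- Both terms expand over the same four products of parts of `a` and `a'`. The coefficients agree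
up to sign on `p p'` and `q q'`, and are opposite in pattern on the mixed ones, whence `g + g'` and
`g - g'`. -/
lemma IsPositiveForm.norm_combination_le {Φ : M →+ M →+ M →+ ℂ} (hΦ : IsPositiveForm Φ)
    {a p q a' p' q' b r s : M} (ha : IsPositiveSplit a p q) (ha' : IsPositiveSplit a' p' q')
    (hb : IsPositiveSplit b r s) (g g' : ℝ) :
    ‖g * Φ a 1 b + g' * Φ 1 a' b‖ ≤ |g + g'| * ((Φ p p' 1).re + (Φ q q' 1).re) +
      |g - g'| * ((Φ p q' 1).re + (Φ q p' 1).re) := by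
  have e : g * Φ a 1 b + g' * Φ 1 a' b = ((g + g' : ℝ) : ℂ) * (Φ p p' b - Φ q q' b) +
      ((g - g' : ℝ) : ℂ) * (Φ p q' b - Φ q p' b) := by
    have h1 : Φ a 1 b = Φ p p' b + Φ p q' b - Φ q p' b - Φ q q' b := by
      rw [ha.2.2.1, ha'.2.2.2]
      simp only [map_sub, map_add, AddMonoidHom.sub_apply, AddMonoidHom.add_apply]
      ring
    have h2 : Φ 1 a' b = Φ p p' b - Φ p q' b + Φ q p' b - Φ q q' b := by
      rw [ha.2.2.2, ha'.2.2.1]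
      simp only [map_sub, map_add, AddMonoidHom.sub_apply, AddMonoidHom.add_apply]
      ring
    rw [h1, h2]
    push_cast
    ring
  rw [e]
  refine (norm_add_le _ _).trans ?_
  rw [norm_mul, norm_mul, Complex.norm_real, Complex.norm_real, Real.norm_eq_abs, Real.norm_eq_abs]
  gcongr
  · exact (norm_sub_le _ _).trans
      (add_le_add (hΦ.norm_le ha.1 ha'.1 hb) (hΦ.norm_le ha.2.1 ha'.2.1 hb))
  · exact (norm_sub_le _ _).trans
      (add_le_add (hΦ.norm_le ha.1 ha'.2.1 hb) (hΦ.norm_le ha.2.1 ha'.1 hb))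

lemma IsPositiveForm.norm_sum_le_two {Φ : M →+ M →+ M →+ ℂ} (hΦ : IsPositiveForm Φ)
    (h1 : Φ 1 1 1 = 1) {A B : Fin 2 → M}
    (hA : ∀ n, ∃ p q, IsPositiveSplit (A n) p q) (hB : ∀ n, ∃ p q, IsPositiveSplit (B n) p q)
    {γ : Fin 2 → Fin 2 → ℝ} (hγ : ∀ n m, |γ n m| ≤ 1)
    (hγ' : γ 0 0 * γ 1 0 = -(γ 0 1 * γ 1 1)) {τ : M → M → ℂ}
    (hτ : ∀ a b, Φ a 1 b = τ a b) (hτ' : ∀ a b, Φ 1 a b = τ a b) :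
    ‖∑ n, ∑ m, (γ n m : ℂ) * τ (A n) (B m)‖ ≤ 2 := by
  obtain ⟨p, q, hpq⟩ := hA 0
  obtain ⟨p', q', hpq'⟩ := hA 1
  obtain ⟨r, s, hrs⟩ := hB 0
  obtain ⟨r', s', hrs'⟩ := hB 1
  have b0 := hΦ.norm_combination_le hpq hpq' hrs (γ 0 0) (γ 1 0)
  have b1 := hΦ.norm_combination_le hpq hpq' hrs' (γ 0 1) (γ 1 1)
  have hone : Φ p p' 1 + Φ q q' 1 + (Φ p q' 1 + Φ q p' 1) = 1 := by
    rw [← h1]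
    conv_rhs => rw [show Φ 1 1 1 = Φ (p + q) (p' + q') 1 by rw [← hpq.2.2.2, ← hpq'.2.2.2]]
    simp only [map_add, AddMonoidHom.add_apply]
    ring
  have hone' := congrArg Complex.re hone
  simp only [Complex.add_re, Complex.one_re] at hone'
  have nonneg : ∀ {x y : M}, 0 ≤ x → 0 ≤ y → 0 ≤ (Φ x y 1).re := fun hx hy =>
    (norm_nonneg _).trans (hΦ.norm_le hx hy hrs)
  have n1 := add_nonneg (nonneg hpq.1 hpq'.1) (nonneg hpq.2.1 hpq'.2.1)
  have n2 := add_nonneg (nonneg hpq.1 hpq'.2.1) (nonneg hpq.2.1 hpq'.1)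
  have c1 := abs_add_abs_le_two (hγ 0 0) (hγ 1 0) (hγ 0 1) (hγ 1 1) hγ'
  -- The condition on `γ` survives a sign change of both `γ 1 0` and `γ 1 1`.
  have c2 : |γ 0 0 - γ 1 0| + |γ 0 1 - γ 1 1| ≤ 2 := by
    rw [sub_eq_add_neg, sub_eq_add_neg]
    exact abs_add_abs_le_two (hγ 0 0) (by rw [abs_neg]; exact hγ 1 0) (hγ 0 1)
      (by rw [abs_neg]; exact hγ 1 1) (by linarith)
  -- `A 0` goes into the first slot and `A 1` into the second.
  have e : ∑ n, ∑ m, (γ n m : ℂ) * τ (A n) (B m) =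
      (γ 0 0 * Φ (A 0) 1 (B 0) + γ 1 0 * Φ 1 (A 1) (B 0)) +
      (γ 0 1 * Φ (A 0) 1 (B 1) + γ 1 1 * Φ 1 (A 1) (B 1)) := by
    simp only [Fin.sum_univ_two, hτ, hτ']
    ring
  rw [e]
  refine (norm_add_le _ _).trans ((add_le_add b0 b1).trans ?_)
  nlinarith [mul_le_mul_of_nonneg_right c1 n1, mul_le_mul_of_nonneg_right c2 n2]

/-- The parts are `(1 ± A) / 2`, positive because `|⟪A x, x⟫| ≤ ‖x‖²`. -/
lemma exists_isPositiveSplit {H : Type*} [NormedAddCommGroup H] [InnerProductSpace ℂ H]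
    [CompleteSpace H] {A : H →L[ℂ] H} (hA : IsSelfAdjoint A) (hA' : ‖A‖ ≤ 1) :
    ∃ P Q, IsPositiveSplit A P Q := by
  have key : ∀ {X : H →L[ℂ] H}, IsSelfAdjoint X → ‖X‖ ≤ 1 → 0 ≤ 1 + X := by
    intro X hX hX'
    rw [ContinuousLinearMap.nonneg_iff_isPositive, ContinuousLinearMap.isPositive_def']
    refine ⟨(IsSelfAdjoint.one _).add hX, fun x => ?_⟩
    have h1 : |(⟪X x, x⟫_ℂ).re| ≤ ‖x‖ ^ 2 := by
      refine (Complex.abs_re_le_norm _).trans ((norm_inner_le_norm _ _).trans ?_)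
      rw [sq]
      gcongr
      exact (X.le_opNorm x).trans (mul_le_of_le_one_left (norm_nonneg _) hX')
    have h2 : (⟪x, x⟫_ℂ).re = ‖x‖ ^ 2 := inner_self_eq_norm_sq (𝕜 := ℂ) x
    have h3 : (1 + X).reApplyInnerSelf x = (⟪x, x⟫_ℂ).re + (⟪X x, x⟫_ℂ).re := by
      rw [ContinuousLinearMap.reApplyInnerSelf_apply, add_apply,
        inner_add_left]
      rfl
    rw [h3, h2]
    linarith [(abs_le.1 h1).1]
  have half : ∀ {X : H →L[ℂ] H}, 0 ≤ X → 0 ≤ (2⁻¹ : ℝ) • X := fun hX =>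
    smul_nonneg (by norm_num) hX
  refine ⟨(2⁻¹ : ℝ) • (1 + A), (2⁻¹ : ℝ) • (1 + -A), half (key hA hA'),
    half (key hA.neg (by rwa [norm_neg])), ?_, ?_⟩
  · module
  · module

end Bell

/-! ### From symmetric DSO states to positive forms. -/

section Main

variable {H : Type u} [NormedAddCommGroup H] [InnerProductSpace ℂ H] [CompleteSpace H]
  {ρ : HTensor H H →L[ℂ] HTensor H H}

lemma trace_comp_opTensor_one (hρ : IsTraceClass ρ) : trace (ρ ∘L opTensor 1 1) = trace ρ := by
  obtain ⟨ι, ⟨e⟩⟩ := exists_basis H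
  have h := hρ.hasSum_trace (basis2 e e)
  simp only [basis2_apply] at h
  exact (hasSum_trace_comp_opTensor hρ e 1 1).unique h

/-- A symmetric DSO state extends to a positive form on triples of observables. -/
lemma IsDSOState.exists_isPositiveForm (hρ : IsDSOState ρ) (hs : IsSymmetricState ρ) :
    ∃ Φ : (H →L[ℂ] H) →+ (H →L[ℂ] H) →+ (H →L[ℂ] H) →+ ℂ, IsPositiveForm Φ ∧
      (∀ A B, Φ A 1 B = trace (ρ ∘L opTensor A B)) ∧
      (∀ A B, Φ 1 A B = trace (ρ ∘L opTensor A B)) := by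
  have hρt := hρ.isDensityOperator.isTraceClass
  obtain ⟨T, hT, hpos⟩ | ⟨T, hT, hpos⟩ := hρ.exists_dso
  · exact ⟨traceForm hT.isTraceClass,
      fun _ _ _ hA hB hC => traceForm_nonneg hT.isTraceClass hpos hA hB hC,
      hT.partialTrace_snd.trace_eq hT.isTraceClass hρt,
      hT.partialTrace_fst.trace_eq hT.isTraceClass hρt⟩
  -- Here the repeated factors are the last two, so the slots are rotated; this produces `tr[ρ (B ⊗
  -- A)]`, and symmetry of `ρ` restores the order.
  · let Φ : (H →L[ℂ] H) →+ (H →L[ℂ] H) →+ (H →L[ℂ] H) →+ ℂ :=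
      AddMonoidHom.mk' (fun A => (traceForm hT.isTraceClass).flip A |>.flip) (fun A A' => by
        ext B C
        simp [AddMonoidHom.flip_apply])
    have hΦ : ∀ A B C, Φ A B C = traceForm hT.isTraceClass C A B := fun _ _ _ => rfl
    refine ⟨Φ, fun _ _ _ hA hB hC => ?_, fun A B => ?_, fun A B => ?_⟩
    · rw [hΦ]
      exact traceForm_nonneg hT.isTraceClass hpos hC hA hB
    · rw [hΦ, traceForm_apply, hT.partialTrace_trd.trace_eq hT.isTraceClass hρt,
        hs.trace_comp_opTensor_comm hρt]
    · rw [hΦ, traceForm_apply, hT.partialTrace_snd.trace_eq hT.isTraceClass hρt,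
        hs.trace_comp_opTensor_comm hρt]

end Main

end QuantumDSO

theorem theorem2 {H : Type*} [NormedAddCommGroup H] [InnerProductSpace ℂ H] [CompleteSpace H]
    [TopologicalSpace.SeparableSpace H]
    (γ : Fin 2 → Fin 2 → ℝ) (hγ : ∀ n m, |γ n m| ≤ 1)
    (hγ' : γ 0 0 * γ 0 1 = -(γ 1 0 * γ 1 1) ∨ γ 0 0 * γ 1 0 = -(γ 0 1 * γ 1 1))
    (ρ : QuantumDSO.HTensor H H →L[ℂ] QuantumDSO.HTensor H H)
    (hρ : QuantumDSO.IsDSOState ρ) (hsymm : QuantumDSO.IsSymmetricState ρ)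
    (A B : Fin 2 → H →L[ℂ] H)
    (hA : ∀ n, IsSelfAdjoint (A n)) (hA' : ∀ n, ‖A n‖ ≤ 1)
    (hB : ∀ m, IsSelfAdjoint (B m)) (hB' : ∀ m, ‖B m‖ ≤ 1) :
    (∀ n m, QuantumDSO.IsTraceClass (ρ ∘L QuantumDSO.opTensor (A n) (B m))) ∧
      ‖∑ n, ∑ m, (γ n m : ℂ) * QuantumDSO.trace (ρ ∘L QuantumDSO.opTensor (A n) (B m))‖ ≤ 2 := by
  have hρt := hρ.isDensityOperator.isTraceClass
  refine ⟨fun n m => hρt.comp_right _, ?_⟩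
  obtain ⟨Φ, hΦ, h1, h2⟩ := hρ.exists_isPositiveForm hsymm
  have hone : Φ 1 1 1 = 1 := by
    rw [h1, QuantumDSO.trace_comp_opTensor_one hρt]
    exact hρ.isDensityOperator.trace_eq_one
  have sA := fun n => QuantumDSO.exists_isPositiveSplit (hA n) (hA' n)
  have sB := fun n => QuantumDSO.exists_isPositiveSplit (hB n) (hB' n)
  obtain hγ' | hγ' := hγ'
  -- Symmetry of `ρ` exchanges `A` with `B` and transposes `γ`, turning this condition into the
  -- other.
  · rw [Finset.sum_comm]
    simp_rw [fun n m => hsymm.trace_comp_opTensor_comm hρt (A n) (B m)]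
    exact hΦ.norm_sum_le_two hone sB sA (γ := fun m n => γ n m) (fun m n => hγ n m) hγ'
      (τ := fun X Y => QuantumDSO.trace (ρ ∘L QuantumDSO.opTensor X Y)) h1 h2
  · exact hΦ.norm_sum_le_two hone sA sB hγ hγ'
      (τ := fun X Y => QuantumDSO.trace (ρ ∘L QuantumDSO.opTensor X Y)) h1 h2
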